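/- **Proposition 5.1.** Let $X_1,\dots,X_n$ be independent random variables with $\mathbb P\{X_j=1\}=p_j$ and $\mathbb P\{X_j=0\}=1-p_j$, where $0\le p_j\le 1$, and put $$W=X_1+\dots+X_n,\qquad \lambda=\sum_{j=1}^n p_j,\qquad \lambda_2=\sum_{j=1}^n p_j^2,\qquad Q=\frac{\lambda}{\max\{1,\lambda-\lambda_2\}}.$$ Let $Z$ be a Poisson random variable with parameter $\lambda$, and let $$\chi^2(W,Z)=\sum_{k=0}^\infty\frac{(\mathbb P\{W=k\}-\mathbb P\{Z=k\})^2}{\mathbb P\{Z=k\}}.$$ There is an absolute constant $c$ with $2.5\cdot 10^{-6}\le c<1$ (independent of $n$ and of the $p_j$) such that, whenever $\lambda\ge \tfrac12$, $$1+\chi^2(W,Z)\ \ge\ c\,\sqrt{Q},$$ and, if moreover $\lambda_2\ge\bigl(1-\tfrac{c^2}{4}\bigr)\lambda$, with the same constant $c$, $$\chi^2(W,Z)\ \ge\ \frac{c}{9}\,\sqrt{Q}.$$ -/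

import Mathlib

open MeasureTheory ProbabilityTheory
open scoped ENNReal

noncomputable section

/-- `X` is a random variable on `(Ω, μ)` that takes the values `1` and `0` with
probabilities `p` and `1 - p`. -/
def IsBernoulliVar {Ω : Type*} [MeasurableSpace Ω] (μ : Measure Ω) (X : Ω → ℕ) (p : ℝ) : Prop :=
  Measurable X ∧ μ.real {ω | X ω = 1} = p ∧ μ.real {ω | X ω = 0} = 1 - p

/-- `Z` is a Poisson random variable on `(Ω, μ)` with parameter `l`. -/
def IsPoissonVar {Ω : Type*} [MeasurableSpace Ω] (μ : Measure Ω) (Z : Ω → ℕ) (l : ℝ) : Prop :=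
  Measurable Z ∧
    ∀ k : ℕ, μ.real {ω | Z ω = k} = l ^ k / (k.factorial : ℝ) * Real.exp (-l)

/-- Pearson's `χ²`-distance `∑ₖ (wₖ - vₖ)² / vₖ` of two `ℕ`-valued random variables `W` and `Z`
(possibly defined on different probability spaces), where `wₖ = P(W = k)` and `vₖ = P(Z = k)`.
It is an element of `[0, ∞]`; a term with `vₖ = 0` is `0` if `wₖ = 0` and `∞` otherwise. -/
def chiSq {Ω Ω' : Type*} [MeasurableSpace Ω] [MeasurableSpace Ω']
    (μ : Measure Ω) (W : Ω → ℕ) (ν : Measure Ω') (Z : Ω' → ℕ) : ℝ≥0∞ :=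
  ∑' k : ℕ, ENNReal.ofReal ((μ.real {ω | W ω = k} - ν.real {ω | Z ω = k}) ^ 2) /
    ENNReal.ofReal (ν.real {ω | Z ω = k})

/-- `λ = p₁ + ⋯ + pₙ`. -/
def lam {n : ℕ} (p : Fin n → ℝ) : ℝ := ∑ j, p j

/-- `λ₂ = p₁² + ⋯ + pₙ²`. -/
def lamTwo {n : ℕ} (p : Fin n → ℝ) : ℝ := ∑ j, p j ^ 2

/-- `Q = λ / max {1, λ - λ₂}`. -/
def Qratio {n : ℕ} (p : Fin n → ℝ) : ℝ := lam p / max 1 (lam p - lamTwo p)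

end

/-!
Write `wₖ = P(W = k)`, `vₖ = P(Z = k)` and `σ² = λ - λ₂ = Var W`. The constant is `c = 1/10`.

Since `w` has finite support, expanding the square gives `1 + χ² = ∑ₖ wₖ² / vₖ`
(`hasSum_sub_sq_div_poissonWeight`). For a finite set `A`, Cauchy-Schwarz bounds this sum below by
`(∑_A wₖ)² / ∑_A vₖ`. Take for `A` the integers within `2 max(1, σ)` of `λ`: by Chebyshev `W` lies
in `A` with probability at least `3/4`, while `A` has at most `5 max(1, σ)` elements, each of
Poisson probability at most `1 / √λ` (`poissonWeight_mul_sqrt_le_one`, from Stirling's bound). The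
quotient is at least `(9/80) √λ / max(1, σ) = (9/80) √Q`, which gives the first inequality
(`sqrt_div_le_sum_sq_div_poissonWeight`).

For the second, test the difference `w - v` against `(k - λ)²`. Its mean is `σ²` under `w` and `λ`
under `v`, and its second moment under `v` is `3λ² + λ`; by Cauchy-Schwarz,
`χ² ≥ λ₂² / (3λ² + λ)` (`sq_div_le_of_hasSum_sub_sq_div`). If `λ ≥ 1/2` and `λ₂` is close to `λ`,
this exceeds `1/8`. Then `9 χ² ≥ 1 + χ²`, so that the second inequality follows from the first.
-/

/-! ### Poisson probabilities and moments -/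

/-- The probability that a Poisson variable with parameter `l` equals `k`. It is written as in
`IsPoissonVar`, with a real parameter, so as to match that definition on the nose. -/
noncomputable def poissonWeight (l : ℝ) (k : ℕ) : ℝ := l ^ k / (k.factorial : ℝ) * Real.exp (-l)

lemma poissonWeight_pos {l : ℝ} (hl : 0 < l) (k : ℕ) : 0 < poissonWeight l k := by
  unfold poissonWeight; positivity

lemma hasSum_poissonWeight (l : ℝ) : HasSum (poissonWeight l) 1 := by
  have h := (NormedSpace.expSeries_div_hasSum_exp l).mul_right (Real.exp (-l))
  rwa [← Real.exp_eq_exp_ℝ, ← Real.exp_add, add_neg_cancel, Real.exp_zero] at h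

/-- The factorial moments of the Poisson distribution are the powers of its parameter. -/
lemma hasSum_poissonWeight_mul_descFactorial (l : ℝ) (j : ℕ) :
    HasSum (fun k : ℕ => poissonWeight l k * (k.descFactorial j : ℝ)) (l ^ j) := by
  rw [← hasSum_nat_add_iff' j, Finset.sum_eq_zero, sub_zero]
  · have h := (hasSum_poissonWeight l).mul_left (l ^ j)
    rw [mul_one] at h
    refine h.congr_fun fun k => ?_
    have hk : ((k + j).factorial : ℝ) = k.factorial * (k + j).descFactorial j := by
      have := Nat.factorial_mul_descFactorial (Nat.le_add_left j k)
      rw [Nat.add_sub_cancel] at this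
      exact_mod_cast this.symm
    have hd : ((k + j).descFactorial j : ℝ) ≠ 0 := by
      exact_mod_cast (Nat.descFactorial_eq_zero_iff_lt.not.mpr (by omega))
    have hf : (k.factorial : ℝ) ≠ 0 := by exact_mod_cast k.factorial_ne_zero
    simp only [poissonWeight, hk, pow_add]
    field_simp
  · intro i hi
    rw [Nat.descFactorial_eq_zero_iff_lt.mpr (Finset.mem_range.mp hi)]
    simp

lemma cast_descFactorial_three_four (k : ℕ) :
    (k.descFactorial 3 : ℝ) = k * (k - 1) * (k - 2) ∧
      (k.descFactorial 4 : ℝ) = k * (k - 1) * (k - 2) * (k - 3) := by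
  rcases k with _ | _ | _ | k <;> simp [Nat.descFactorial_succ]
  constructor <;> ring

lemma hasSum_poissonWeight_mul_sub_sq (l : ℝ) :
    HasSum (fun k : ℕ => poissonWeight l k * ((k : ℝ) - l) ^ 2) l := by
  have h0 := hasSum_poissonWeight l
  have h1 := hasSum_poissonWeight_mul_descFactorial l 1
  have h2 := hasSum_poissonWeight_mul_descFactorial l 2
  have h := (h2.add (h1.mul_left (1 - 2 * l))).add (h0.mul_left (l ^ 2))
  convert h using 1
  · funext k
    rw [Nat.cast_descFactorial_two, Nat.descFactorial_one]
    ring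
  · ring

lemma hasSum_poissonWeight_mul_sub_pow_four (l : ℝ) :
    HasSum (fun k : ℕ => poissonWeight l k * ((k : ℝ) - l) ^ 4) (3 * l ^ 2 + l) := by
  have h0 := hasSum_poissonWeight l
  have h1 := hasSum_poissonWeight_mul_descFactorial l 1
  have h2 := hasSum_poissonWeight_mul_descFactorial l 2
  have h3 := hasSum_poissonWeight_mul_descFactorial l 3
  have h4 := hasSum_poissonWeight_mul_descFactorial l 4
  have h := (((h4.add (h3.mul_left (6 - 4 * l))).add (h2.mul_left (7 - 12 * l + 6 * l ^ 2))).add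
    (h1.mul_left (1 - 4 * l + 6 * l ^ 2 - 4 * l ^ 3))).add (h0.mul_left (l ^ 4))
  convert h using 1
  · funext k
    rw [(cast_descFactorial_three_four k).1, (cast_descFactorial_three_four k).2,
      Nat.cast_descFactorial_two, Nat.descFactorial_one]
    ring
  · ring

/-- The weight at `k` is largest when the parameter is `k`, where Stirling's formula bounds it. -/
lemma poissonWeight_le_stirling {l : ℝ} (hl : 0 ≤ l) {k : ℕ} (hk : k ≠ 0) :
    poissonWeight l k * √(2 * Real.pi * k) ≤ 1 := by
  have hk0 : (0 : ℝ) < k := by positivity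
  have h1 : l ^ k * Real.exp (-l) ≤ (k / Real.exp 1) ^ k := by
    have h : l ≤ k * Real.exp (l / k - 1) := by
      have := Real.add_one_le_exp (l / k - 1)
      rw [sub_add_cancel, div_le_iff₀ hk0] at this
      linarith
    calc l ^ k * Real.exp (-l) ≤ (k * Real.exp (l / k - 1)) ^ k * Real.exp (-l) := by gcongr
      _ = (k : ℝ) ^ k * Real.exp (-k) := by
        rw [mul_pow, ← Real.exp_nat_mul, mul_assoc, ← Real.exp_add]
        congr 2
        field_simp
        ring
      _ = (k / Real.exp 1) ^ k := by
        rw [div_pow, ← Real.exp_nat_mul, mul_one, Real.exp_neg, div_eq_mul_inv]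
  have hf : (0 : ℝ) < k.factorial := by positivity
  rw [poissonWeight, div_mul_eq_mul_div, div_mul_eq_mul_div, div_le_one hf]
  calc l ^ k * Real.exp (-l) * √(2 * Real.pi * k)
      ≤ (k / Real.exp 1) ^ k * √(2 * Real.pi * k) := by gcongr
    _ ≤ k.factorial := by
      rw [mul_comm]; exact Stirling.le_factorial_stirling k

/-- The Poisson weights increase up to the parameter. -/
lemma poissonWeight_le_of_le {l : ℝ} (hl : 0 ≤ l) {k m : ℕ} (hkm : k ≤ m) (hm : (m : ℝ) ≤ l) :
    poissonWeight l k ≤ poissonWeight l m := by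
  induction m, hkm using Nat.le_induction with
  | base => rfl
  | succ m hkm ih =>
    push_cast at hm
    refine (ih (by linarith)).trans ?_
    have hm0 : (0 : ℝ) < (m : ℝ) + 1 := by positivity
    have : poissonWeight l (m + 1) = poissonWeight l m * (l / (m + 1)) := by
      simp only [poissonWeight, Nat.factorial_succ, pow_succ]
      push_cast
      field_simp
    rw [this]
    refine le_mul_of_one_le_right (by unfold poissonWeight; positivity) ?_
    rwa [one_le_div hm0]

/-- Every Poisson probability is at most `1 / √l`. The mode is `m = ⌊l⌋`: from there on Stirling's
bound applies, and below it the weights increase. -/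
lemma poissonWeight_mul_sqrt_le_one {l : ℝ} (hl : 0 < l) (k : ℕ) :
    poissonWeight l k * √l ≤ 1 := by
  rcases le_total l 1 with h1 | h1
  · refine mul_le_one₀ ?_ (Real.sqrt_nonneg l) (Real.sqrt_le_one.mpr h1)
    exact le_hasSum (hasSum_poissonWeight l) k fun j _ => (poissonWeight_pos hl j).le
  · have hm : 1 ≤ ⌊l⌋₊ := Nat.one_le_floor_iff _ |>.mpr h1
    have hlt := Nat.lt_floor_add_one l
    have hm1 : (1 : ℝ) ≤ ⌊l⌋₊ := by exact_mod_cast hm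
    have key : ∀ j : ℕ, ⌊l⌋₊ ≤ j → poissonWeight l j * √l ≤ 1 := by
      intro j hj
      refine le_trans ?_ (poissonWeight_le_stirling hl.le (k := j) (by omega))
      have hj' : (⌊l⌋₊ : ℝ) ≤ j := by exact_mod_cast hj
      have hp := (poissonWeight_pos hl j).le
      gcongr
      -- `l < ⌊l⌋ + 1 ≤ 2 ⌊l⌋ ≤ 2 j`
      nlinarith [Real.pi_gt_three]
    rcases le_total ⌊l⌋₊ k with h | h
    · exact key k h
    · refine le_trans ?_ (key _ le_rfl)
      gcongr
      exact poissonWeight_le_of_le hl.le h (Nat.floor_le hl.le)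

/-! ### Lower bounds for the chi-squared sum of a finitely supported sequence -/

lemma card_filter_abs_sub_le {l r : ℝ} (hr : 0 ≤ r) (s : Finset ℕ) :
    ((s.filter fun k : ℕ => |(k : ℝ) - l| ≤ r).card : ℝ) ≤ 2 * r + 1 := by
  by_cases h : 0 ≤ l + r
  · have hsub : (s.filter fun k : ℕ => |(k : ℝ) - l| ≤ r) ⊆ Finset.Icc ⌈l - r⌉₊ ⌊l + r⌋₊ := by
      intro k hk
      have hk' := abs_le.mp (Finset.mem_filter.mp hk).2
      rw [Finset.mem_Icc]
      exact ⟨Nat.ceil_le.mpr (by linarith), Nat.le_floor (by linarith)⟩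
    have hc := Finset.card_le_card hsub
    rw [Nat.card_Icc] at hc
    have h1 := Nat.floor_le h
    have h2 := Nat.le_ceil (l - r)
    rcases le_total ⌈l - r⌉₊ (⌊l + r⌋₊ + 1) with h3 | h3
    · have : ((s.filter fun k : ℕ => |(k : ℝ) - l| ≤ r).card : ℝ) + ⌈l - r⌉₊ ≤ ⌊l + r⌋₊ + 1 := by
        exact_mod_cast (by omega)
      linarith
    · have : (s.filter fun k : ℕ => |(k : ℝ) - l| ≤ r).card = 0 := by omega
      rw [this]; push_cast; linarith
  · rw [Finset.filter_false_of_mem]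
    · simp; linarith
    · intro k _ hk
      have := (abs_le.mp hk).2
      have : (0 : ℝ) ≤ k := by positivity
      linarith

/-- Chebyshev's inequality at two standard deviations, for a finitely supported distribution. -/
lemma three_quarters_le_sum_filter {w : ℕ → ℝ} (hw : ∀ k, 0 ≤ w k) {s : Finset ℕ} {l v r : ℝ}
    (h1 : ∑ k ∈ s, w k = 1) (h2 : ∑ k ∈ s, w k * ((k : ℝ) - l) ^ 2 = v) (hr : 0 < r)
    (hv : v ≤ r ^ 2) :
    3 / 4 ≤ ∑ k ∈ s.filter (fun k : ℕ => |(k : ℝ) - l| ≤ 2 * r), w k := by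
  have h3 : ∑ k ∈ s.filter (fun k : ℕ => ¬ |(k : ℝ) - l| ≤ 2 * r), w k * (2 * r) ^ 2 ≤ v := by
    rw [← h2]
    refine (Finset.sum_le_sum fun k hk => ?_).trans
      (Finset.sum_le_sum_of_subset_of_nonneg (Finset.filter_subset _ s)
        fun k _ _ => mul_nonneg (hw k) (sq_nonneg _))
    have hk' := (not_le.mp (Finset.mem_filter.mp hk).2).le
    refine mul_le_mul_of_nonneg_left ?_ (hw k)
    rw [← sq_abs ((k : ℝ) - l)]
    gcongr
  rw [← Finset.sum_mul] at h3
  have h4 := Finset.sum_filter_add_sum_filter_not s (fun k : ℕ => |(k : ℝ) - l| ≤ 2 * r) w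
  have hr2 : 0 < r ^ 2 := by positivity
  nlinarith

/-- A distribution of mean square deviation `v` about `l` is spread over few integers compared
with the Poisson distribution when `v` is small relative to `l`, which makes
`∑ₖ wₖ² / vₖ` large. -/
lemma sqrt_div_le_sum_sq_div_poissonWeight {w : ℕ → ℝ} (hw : ∀ k, 0 ≤ w k) {s : Finset ℕ} {l v : ℝ}
    (hl : 0 < l) (h1 : ∑ k ∈ s, w k = 1) (h2 : ∑ k ∈ s, w k * ((k : ℝ) - l) ^ 2 = v) :
    1 / 10 * √(l / max 1 v) ≤ ∑ k ∈ s, w k ^ 2 / poissonWeight l k := by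
  set r := √(max 1 v) with hr
  have hm : (1 : ℝ) ≤ max 1 v := le_max_left _ _
  have hr1 : 1 ≤ r := Real.one_le_sqrt.mpr hm
  have hr0 : 0 < r := by linarith
  have hrv : v ≤ r ^ 2 := by rw [hr, Real.sq_sqrt (by linarith)]; exact le_max_right _ _
  have hA := three_quarters_le_sum_filter hw h1 h2 hr0 hrv
  set A := s.filter (fun k : ℕ => |(k : ℝ) - l| ≤ 2 * r) with hAdef
  have hcard : (A.card : ℝ) ≤ 5 * r := by
    have := card_filter_abs_sub_le (l := l) (r := 2 * r) (by linarith) s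
    rw [← hAdef] at this
    linarith
  have hv : (∑ k ∈ A, poissonWeight l k) * √l ≤ 5 * r := by
    rw [Finset.sum_mul]
    refine (Finset.sum_le_card_nsmul _ _ 1 fun k _ => poissonWeight_mul_sqrt_le_one hl k).trans ?_
    simpa using hcard
  have hAne : A.Nonempty := by
    by_contra h
    rw [Finset.not_nonempty_iff_eq_empty.mp h] at hA
    norm_num at hA
  have hv0 : 0 < ∑ k ∈ A, poissonWeight l k :=
    Finset.sum_pos (fun k _ => poissonWeight_pos hl k) hAne
  calc 1 / 10 * √(l / max 1 v) = 1 / 10 * (√l / r) := by rw [Real.sqrt_div hl.le]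
    _ ≤ (3 / 4) ^ 2 / ∑ k ∈ A, poissonWeight l k := by
      rw [le_div_iff₀ hv0]
      have : (∑ k ∈ A, poissonWeight l k) * √l / r ≤ 5 := (div_le_iff₀ hr0).mpr hv
      calc 1 / 10 * (√l / r) * ∑ k ∈ A, poissonWeight l k
          = 1 / 10 * ((∑ k ∈ A, poissonWeight l k) * √l / r) := by ring
        _ ≤ (3 / 4) ^ 2 := by linarith
    _ ≤ (∑ k ∈ A, w k) ^ 2 / ∑ k ∈ A, poissonWeight l k := by gcongr
    _ ≤ ∑ k ∈ A, w k ^ 2 / poissonWeight l k :=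
      Finset.sq_sum_div_le_sum_sq_div A w fun k _ => poissonWeight_pos hl k
    _ ≤ ∑ k ∈ s, w k ^ 2 / poissonWeight l k :=
      Finset.sum_le_sum_of_subset_of_nonneg (Finset.filter_subset _ s)
        fun k _ _ => div_nonneg (sq_nonneg _) (poissonWeight_pos hl k).le

lemma hasSum_sub_sq_div_poissonWeight {w : ℕ → ℝ} {s : Finset ℕ} {l : ℝ}
    (hl : 0 < l) (hs : ∀ k ∉ s, w k = 0) (h1 : ∑ k ∈ s, w k = 1) :
    HasSum (fun k => (w k - poissonWeight l k) ^ 2 / poissonWeight l k)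
      (∑ k ∈ s, w k ^ 2 / poissonWeight l k - 1) := by
  have hA : HasSum (fun k => w k ^ 2 / poissonWeight l k) (∑ k ∈ s, w k ^ 2 / poissonWeight l k) :=
    hasSum_sum_of_ne_finset_zero fun k hk => by simp [hs k hk]
  have hB : HasSum w 1 := h1 ▸ hasSum_sum_of_ne_finset_zero hs
  have hC := (hA.sub (hB.mul_left 2)).add (hasSum_poissonWeight l)
  rw [show ∑ k ∈ s, w k ^ 2 / poissonWeight l k - 1
    = ∑ k ∈ s, w k ^ 2 / poissonWeight l k - 2 * 1 + 1 by ring]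
  refine hC.congr_fun fun k => ?_
  have := (poissonWeight_pos hl k).ne'
  field_simp
  ring

/-- Cauchy-Schwarz with the test function `(k - l) ^ 2`. -/
lemma sq_div_le_of_hasSum_sub_sq_div {w : ℕ → ℝ} {s : Finset ℕ} {l v T : ℝ}
    (hl : 0 < l) (hs : ∀ k ∉ s, w k = 0)
    (h2 : ∑ k ∈ s, w k * ((k : ℝ) - l) ^ 2 = v)
    (hT : HasSum (fun k => (w k - poissonWeight l k) ^ 2 / poissonWeight l k) T) :
    (l - v) ^ 2 / (3 * l ^ 2 + l) ≤ T := by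
  have hW : HasSum (fun k : ℕ => w k * ((k : ℝ) - l) ^ 2) v :=
    h2 ▸ hasSum_sum_of_ne_finset_zero fun k hk => by simp [hs k hk]
  -- Cauchy-Schwarz as `(w - v)² / v ≥ 2 t (w - v) f - t² v f²`, at the `t` that makes it sharpest.
  set t := (v - l) / (3 * l ^ 2 + l) with ht
  have hS := ((hW.sub (hasSum_poissonWeight_mul_sub_sq l)).mul_left (2 * t)).sub
    ((hasSum_poissonWeight_mul_sub_pow_four l).mul_left (t ^ 2))
  have hle := hasSum_le (fun k => ?_) hS hT
  · refine le_trans (le_of_eq ?_) hle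
    have : 3 * l ^ 2 + l ≠ 0 := by positivity
    rw [ht]
    field_simp
    ring
  · have hp := poissonWeight_pos hl k
    rw [le_div_iff₀ hp]
    nlinarith [sq_nonneg (w k - poissonWeight l k - t * poissonWeight l k * ((k : ℝ) - l) ^ 2)]

/-! ### Sums of independent Bernoulli variables -/

section Bernoulli

variable {Ω : Type*} [MeasurableSpace Ω] {μ : Measure Ω} [IsProbabilityMeasure μ]

lemma IsBernoulliVar.ae_le_one {X : Ω → ℕ} {p : ℝ} (h : IsBernoulliVar μ X p) :
    ∀ᵐ ω ∂μ, X ω ≤ 1 := by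
  obtain ⟨hX, h1, h0⟩ := h
  have hm : ∀ k, MeasurableSet {ω | X ω = k} := fun k => hX (measurableSet_singleton k)
  have hU : μ.real ({ω | X ω = 1} ∪ {ω | X ω = 0}) = 1 := by
    rw [measureReal_union _ (hm 0), h1, h0]
    · ring
    · exact Set.disjoint_left.mpr fun ω (h : X ω = 1) (h' : X ω = 0) => by omega
  have hU' : ∀ᵐ ω ∂μ, ω ∈ {ω | X ω = 1} ∪ {ω | X ω = 0} := by
    refine (mem_ae_iff_prob_eq_one ((hm 1).union (hm 0))).mpr ?_
    rwa [measureReal_def, ENNReal.toReal_eq_one_iff] at hU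
  filter_upwards [hU'] with ω hω
  rcases hω with h | h
  · exact le_of_eq h
  · exact (le_of_eq h).trans zero_le_one

lemma integral_comp_eq_sum {W : Ω → ℕ} (hW : Measurable W) {n : ℕ} (hn : ∀ᵐ ω ∂μ, W ω ≤ n)
    (f : ℕ → ℝ) :
    ∫ ω, f (W ω) ∂μ = ∑ k ∈ Finset.range (n + 1), μ.real {ω | W ω = k} * f k := by
  have hm : ∀ k, MeasurableSet {ω | W ω = k} := fun k => hW (measurableSet_singleton k)
  have h : (fun ω => f (W ω)) =ᵐ[μ]
      fun ω => ∑ k ∈ Finset.range (n + 1), {ω | W ω = k}.indicator (fun _ => f k) ω := by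
    filter_upwards [hn] with ω hω
    simp only [Set.indicator_apply, Set.mem_ofPred_eq]
    rw [Finset.sum_ite_eq, if_pos (Finset.mem_range.mpr (by omega))]
  rw [integral_congr_ae h, integral_finsetSum]
  · exact Finset.sum_congr rfl fun k _ => by rw [integral_indicator_const _ (hm k), smul_eq_mul]
  · exact fun k _ => (integrable_const _).indicator (hm k)

lemma IsBernoulliVar.memLp {X : Ω → ℕ} {p : ℝ} (h : IsBernoulliVar μ X p) :
    MemLp (fun ω => (X ω : ℝ)) 2 μ := by
  refine MemLp.of_bound (measurable_from_top.comp h.1).aestronglyMeasurable 1 ?_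
  filter_upwards [h.ae_le_one] with ω hω
  simpa using hω

lemma IsBernoulliVar.integral_comp {X : Ω → ℕ} {p : ℝ} (h : IsBernoulliVar μ X p) (f : ℕ → ℝ) :
    ∫ ω, f (X ω) ∂μ = (1 - p) * f 0 + p * f 1 := by
  rw [integral_comp_eq_sum h.1 h.ae_le_one, Finset.sum_range_succ, Finset.sum_range_one, h.2.1,
    h.2.2]

lemma IsBernoulliVar.variance_eq {X : Ω → ℕ} {p : ℝ} (h : IsBernoulliVar μ X p) :
    Var[fun ω => (X ω : ℝ); μ] = p - p ^ 2 := by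
  rw [variance_eq_sub h.memLp]
  have h1 := h.integral_comp (fun k => (k : ℝ))
  have h2 := h.integral_comp (fun k => (k : ℝ) ^ 2)
  simp only [Pi.pow_apply, h1, h2]
  push_cast
  ring

variable {n : ℕ} {p : Fin n → ℝ} {X : Fin n → Ω → ℕ}

lemma ae_sum_le (hX : ∀ j, IsBernoulliVar μ (X j) (p j)) : ∀ᵐ ω ∂μ, ∑ j, X j ω ≤ n := by
  filter_upwards [ae_all_iff.mpr fun j => (hX j).ae_le_one] with ω hω
  simpa using Finset.sum_le_card_nsmul Finset.univ (fun j => X j ω) 1 fun j _ => hω j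

/-- The variance of `W` is `λ - λ₂`. -/
lemma integral_sum_sub_lam_sq (hX : ∀ j, IsBernoulliVar μ (X j) (p j)) (hind : iIndepFun X μ) :
    ∫ ω, (((∑ j, X j ω : ℕ) : ℝ) - lam p) ^ 2 ∂μ = lam p - lamTwo p := by
  have hcast : Measurable (fun k : ℕ => (k : ℝ)) := measurable_from_top
  have hvar := IndepFun.variance_sum (μ := μ) (X := fun j ω => (X j ω : ℝ)) (s := Finset.univ)
    (fun j _ => (hX j).memLp)
    (fun i _ j _ hij => (hind.indepFun hij).comp hcast hcast)
  simp only [(hX _).variance_eq, Finset.sum_sub_distrib] at hvar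
  have hmean : ∫ ω, (∑ j, fun ω => (X j ω : ℝ)) ω ∂μ = lam p := by
    simp only [Finset.sum_apply]
    rw [integral_finsetSum _ fun j _ => (hX j).memLp.integrable one_le_two]
    refine Finset.sum_congr rfl fun j _ => ?_
    have := (hX j).integral_comp (fun k => (k : ℝ))
    simpa using this
  rw [variance_eq_integral, hmean] at hvar
  · rw [lam, lamTwo, ← hvar, ← lam]
    simp [Finset.sum_apply]
  · exact (memLp_finsetSum' _ fun j _ => (hX j).memLp).aemeasurable

end Bernoulli

/-! ### The chi-squared distance to a Poisson variable -/

lemma chiSq_eq_ofReal {Ω Ω' : Type*} [MeasurableSpace Ω] [MeasurableSpace Ω']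
    {μ : Measure Ω} {W : Ω → ℕ} {ν : Measure Ω'} {Z : Ω' → ℕ} {l T : ℝ} (hl : 0 < l)
    (hZ : IsPoissonVar ν Z l)
    (hT : HasSum (fun k => (μ.real {ω | W ω = k} - poissonWeight l k) ^ 2 / poissonWeight l k) T) :
    chiSq μ W ν Z = ENNReal.ofReal T := by
  have hv : ∀ k, ν.real {ω | Z ω = k} = poissonWeight l k := hZ.2
  rw [← hT.tsum_eq, ENNReal.ofReal_tsum_of_nonneg
    (fun k => div_nonneg (sq_nonneg _) (poissonWeight_pos hl k).le) hT.summable]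
  refine tsum_congr fun k => ?_
  rw [hv, ENNReal.ofReal_div_of_pos (poissonWeight_pos hl k)]

theorem proposition5p1 :
    ∃ c : ℝ, 2.5 * 10 ^ (-6 : ℤ) ≤ c ∧ c < 1 ∧
      ∀ (n : ℕ) (p : Fin n → ℝ), (∀ j, 0 ≤ p j ∧ p j ≤ 1) → 1 / 2 ≤ lam p →
      ∀ (Ω : Type*) [MeasurableSpace Ω] (μ : Measure Ω) [IsProbabilityMeasure μ]
        (X : Fin n → Ω → ℕ), (∀ j, IsBernoulliVar μ (X j) (p j)) → iIndepFun X μ →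
      ∀ (Ω' : Type*) [MeasurableSpace Ω'] (ν : Measure Ω') [IsProbabilityMeasure ν]
        (Z : Ω' → ℕ), IsPoissonVar ν Z (lam p) →
        ENNReal.ofReal (c * √(Qratio p)) ≤ 1 + chiSq μ (fun ω => ∑ j, X j ω) ν Z ∧
        ((1 - c ^ 2 / 4) * lam p ≤ lamTwo p →
          ENNReal.ofReal (c / 9 * √(Qratio p)) ≤ chiSq μ (fun ω => ∑ j, X j ω) ν Z) := by
  refine ⟨1 / 10, by norm_num, by norm_num, ?_⟩
  intro n p _ hl Ω _ μ _ X hX hind Ω' _ ν _ Z hZ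
  have hl0 : 0 < lam p := by linarith
  have hWm : Measurable fun ω => ∑ j, X j ω := Finset.measurable_fun_sum _ fun j _ => (hX j).1
  have hWn := ae_sum_le hX
  set w : ℕ → ℝ := fun k => μ.real {ω | ∑ j, X j ω = k} with hw
  have hw0 : ∀ k, 0 ≤ w k := fun k => measureReal_nonneg
  have hws : ∀ k ∉ Finset.range (n + 1), w k = 0 := by
    intro k hk
    rw [Finset.mem_range, not_lt] at hk
    have : μ {ω | ∑ j, X j ω = k} = 0 :=
      measure_mono_null (fun ω (h : _ = _) => by
        simp only [Set.mem_compl_iff, Set.mem_ofPred_eq]; omega)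
        (mem_ae_iff.mp hWn)
    simp [hw, measureReal_def, this]
  have h1 : ∑ k ∈ Finset.range (n + 1), w k = 1 := by
    simpa using (integral_comp_eq_sum hWm hWn fun _ => 1).symm
  have h2 : ∑ k ∈ Finset.range (n + 1), w k * ((k : ℝ) - lam p) ^ 2 = lam p - lamTwo p := by
    rw [← integral_sum_sub_lam_sq hX hind]
    exact (integral_comp_eq_sum hWm hWn fun k => ((k : ℝ) - lam p) ^ 2).symm
  have hT := hasSum_sub_sq_div_poissonWeight hl0 hws h1
  have hQ := sqrt_div_le_sum_sq_div_poissonWeight hw0 hl0 h1 h2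
  have hV := sq_div_le_of_hasSum_sub_sq_div hl0 hws h2 hT
  have hT0 := hT.nonneg fun k => div_nonneg (sq_nonneg _) (poissonWeight_pos hl0 k).le
  rw [chiSq_eq_ofReal hl0 hZ hT, Qratio]
  set T := ∑ k ∈ Finset.range (n + 1), w k ^ 2 / poissonWeight (lam p) k
  refine ⟨?_, fun h => ?_⟩
  · rw [← ENNReal.ofReal_one, ← ENNReal.ofReal_add zero_le_one hT0]
    exact ENNReal.ofReal_le_ofReal (by linarith)
  · refine ENNReal.ofReal_le_ofReal ?_
    have h8 : 1 / 8 ≤ T - 1 := by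
      -- `λ₂ ≥ (399/400) λ` and `3λ² + λ ≤ 5λ²`, the latter because `λ ≥ 1/2`.
      refine le_trans ?_ hV
      rw [le_div_iff₀ (by positivity)]
      nlinarith
    linarith
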